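/- Consider $L$ links. Link $l$ has $a_l$ transmit and $b_l$ receive antennas; $\mathbf H_{l,k}\in\mathbb C^{b_l\times a_k}$ is the channel from the transmitter of link $k$ to the receiver of link $l$, and $\mathbf H_{l,l}\neq 0$ for every $l$. Let $\mathbf\Phi\in\mathbb R_+^{L\times L}$ be a coupling matrix with $\Phi_{l,l}=0$ for all $l$ (for instance a $0/1$ matrix, $\Phi_{l,k}=1$ if the signal of link $k$ interferes with link $l$), and let $P_T$ be a real number (the sum power). For positive semidefinite $\mathbf\Sigma_k\in\mathbb C^{a_k\times a_k}$ ($k=1,\dots,L$) put $\mathbf\Omega_l=\mathbf I+\sum_{k}\Phi_{l,k}\mathbf H_{l,k}\mathbf\Sigma_k\mathbf H_{l,k}^\dagger$ and $\mathcal I_l(\mathbf\Sigma_{1:L})=\log\bigl|\mathbf I+\mathbf H_{l,l}\mathbf\Sigma_l\mathbf H_{l,l}^\dagger\mathbf\Omega_l^{-1}\bigr|$. The rate region $\mathcal R_{\mathbf\Phi}(P_T)$ is the set of all $\mathbf r\in\mathbb R_+^L$ for which there are $\mathbf\Sigma_1,\dots,\mathbf\Sigma_L\succeq0$ with $\sum_l\mathrm{Tr}(\mathbf\Sigma_l)\le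 P_T$ and $r_l\le\mathcal I_l(\mathbf\Sigma_{1:L})$ for all $l$. Let $M_l=\mathrm{rank}(\mathbf H_{l,l})$ be the number of data streams of link $l$. For unit transmit vectors $\mathbf t_{l,m}\in\mathbb C^{a_l}$, unit receive vectors $\mathbf r_{l,m}\in\mathbb C^{b_l}$ and powers $p_{l,m}\ge0$ ($1\le m\le M_l$, $1\le l\le L$), the SINR of stream $m$ of link $l$ is $$\gamma_{l,m}=\frac{p_{l,m}\,|\mathbf r_{l,m}^\dagger\mathbf H_{l,l}\mathbf t_{l,m}|^2}{1+\sum_{k=1}^L\sum_{n=1}^{M_k}p_{k,n}\Psi_{l,m}^{k,n}},$$ where $\Psi_{l,m}^{k,n}=\Phi_{l,k}|\mathbf r_{l,m}^\dagger\mathbf H_{l,k}\mathbf t_{k,n}|^2$ if $k\ne l$, $\Psi_{l,m}^{l,n}=|\mathbf r_{l,m}^\dagger\mathbf H_{l,l}\mathbf t_{l,n}|^2$ if $m<n$, and $\Psi_{l,m}^{l,n}=0$ if $m\ge n$. The SINR region $\mathcal T_{\mathbf\Phi}(P_T)$ is the set of all vectors $[\gamma_{l,m}]_{m=1,\dots,M_l,\,l=1,\dots,L}$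 obtained in this way with $\sum_{l,m}p_{l,m}\le P_T$. A point of a set of real vectors is Pareto-optimal in the set if no other point of the set is at least as large in every coordinate. Then for all real $\mathcal I_1,\dots,\mathcal I_L$: the SINR point $[\gamma_{l,m}=e^{\mathcal I_l/M_l}-1]_{m=1,\dots,M_l,\,l=1,\dots,L}$ belongs to $\mathcal T_{\mathbf\Phi}(P_T)$ and is Pareto-optimal in it if and only if the rate point $[\mathcal I_l]_{l=1,\dots,L}$ belongs to $\mathcal R_{\mathbf\Phi}(P_T)$ and is Pareto-optimal in it. -/

import Mathlib

open Matrix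
open scoped ComplexOrder

namespace BMAC

variable {L : ℕ} {tx rx : Fin L → ℕ}

/-- The interference-plus-noise covariance matrix of link `l`,
`Ω_l = I + ∑ k, Φ_{l,k} H_{l,k} Σ_k H_{l,k}†`. Link `k` has `tx k` transmit and `rx k` receive
antennas, and `H l k` is the channel from the transmitter of link `k` to the receiver of
link `l`. -/
noncomputable def interferenceCov (H : ∀ l k : Fin L, Matrix (Fin (rx l)) (Fin (tx k)) ℂ)
    (Φ : Matrix (Fin L) (Fin L) ℝ) (S : ∀ k : Fin L, Matrix (Fin (tx k)) (Fin (tx k)) ℂ)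
    (l : Fin L) : Matrix (Fin (rx l)) (Fin (rx l)) ℂ :=
  1 + ∑ k, (Φ l k : ℂ) • (H l k * S k * (H l k)ᴴ)

/-- The rate `log |I + H_{l,l} Σ_l H_{l,l}† Ω_l⁻¹|` of link `l`. For positive semidefinite
covariances and nonnegative `Φ` this determinant is a real number `≥ 1`, so that taking its
real part loses nothing. -/
noncomputable def rate (H : ∀ l k : Fin L, Matrix (Fin (rx l)) (Fin (tx k)) ℂ)
    (Φ : Matrix (Fin L) (Fin L) ℝ) (S : ∀ k : Fin L, Matrix (Fin (tx k)) (Fin (tx k)) ℂ)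
    (l : Fin L) : ℝ :=
  Real.log (det (1 + H l l * S l * (H l l)ᴴ * (interferenceCov H Φ S l)⁻¹)).re

/-- The achievable rate region for the coupling matrix `Φ` and the sum power `P`. -/
def rateRegion (H : ∀ l k : Fin L, Matrix (Fin (rx l)) (Fin (tx k)) ℂ)
    (Φ : Matrix (Fin L) (Fin L) ℝ) (P : ℝ) : Set (Fin L → ℝ) :=
  {r | ∃ S : ∀ k : Fin L, Matrix (Fin (tx k)) (Fin (tx k)) ℂ,
    (∀ k, (S k).PosSemidef) ∧ ∑ k, (trace (S k)).re ≤ P ∧ ∀ l, 0 ≤ r l ∧ r l ≤ rate H Φ S l}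

/-- The gain `|r† A t|²` of a stream with transmit vector `t` and receive vector `r` over the
channel `A`. -/
noncomputable def gain {a b : ℕ} (A : Matrix (Fin a) (Fin b) ℂ) (r : EuclideanSpace ℂ (Fin a))
    (t : EuclideanSpace ℂ (Fin b)) : ℝ :=
  ‖star r.ofLp ⬝ᵥ (A *ᵥ t.ofLp)‖ ^ 2

variable {M : Fin L → ℕ}

/-- The cross-talk from stream `n` of link `k` to stream `m` of link `l`. The streams of one link
are decoded and cancelled in increasing order, so inside a link only later streams interfere
with stream `m`. -/
noncomputable def crossTalk (H : ∀ l k : Fin L, Matrix (Fin (rx l)) (Fin (tx k)) ℂ)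
    (Φ : Matrix (Fin L) (Fin L) ℝ)
    (T : ∀ l : Fin L, Fin (M l) → EuclideanSpace ℂ (Fin (tx l)))
    (R : ∀ l : Fin L, Fin (M l) → EuclideanSpace ℂ (Fin (rx l)))
    (l : Fin L) (m : Fin (M l)) (k : Fin L) (n : Fin (M k)) : ℝ :=
  if k = l then
    if (m : ℕ) < (n : ℕ) then gain (H l k) (R l m) (T k n) else 0
  else Φ l k * gain (H l k) (R l m) (T k n)

/-- The SINR of stream `m` of link `l` under the strategy with transmit vectors `T`, receive
vectors `R` and transmit powers `p`. -/
noncomputable def sinr (H : ∀ l k : Fin L, Matrix (Fin (rx l)) (Fin (tx k)) ℂ)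
    (Φ : Matrix (Fin L) (Fin L) ℝ)
    (T : ∀ l : Fin L, Fin (M l) → EuclideanSpace ℂ (Fin (tx l)))
    (R : ∀ l : Fin L, Fin (M l) → EuclideanSpace ℂ (Fin (rx l)))
    (p : ∀ l : Fin L, Fin (M l) → ℝ) (l : Fin L) (m : Fin (M l)) : ℝ :=
  p l m * gain (H l l) (R l m) (T l m) /
    (1 + ∑ k, ∑ n, p k n * crossTalk H Φ T R l m k n)

/-- The achievable SINR region with `M l` streams on link `l`: all SINR vectors achieved by unit
transmit vectors, unit receive vectors and nonnegative powers of sum at most `P`. -/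
def sinrRegion (H : ∀ l k : Fin L, Matrix (Fin (rx l)) (Fin (tx k)) ℂ)
    (Φ : Matrix (Fin L) (Fin L) ℝ) (M : Fin L → ℕ) (P : ℝ) :
    Set (∀ l : Fin L, Fin (M l) → ℝ) :=
  {γ | ∃ (T : ∀ l : Fin L, Fin (M l) → EuclideanSpace ℂ (Fin (tx l)))
      (R : ∀ l : Fin L, Fin (M l) → EuclideanSpace ℂ (Fin (rx l)))
      (p : ∀ l : Fin L, Fin (M l) → ℝ),
    (∀ l m, ‖T l m‖ = 1) ∧ (∀ l m, ‖R l m‖ = 1) ∧ (∀ l m, 0 ≤ p l m) ∧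
      ∑ l, ∑ m, p l m ≤ P ∧ ∀ l m, γ l m = sinr H Φ T R p l m}

/-- `x` is Pareto-optimal in `S`: it lies in `S`, and no other point of `S` is at least as large
in every coordinate. -/
def IsParetoOptimal {α : Type*} [PartialOrder α] (S : Set α) (x : α) : Prop :=
  Maximal (fun y => y ∈ S) x

end BMAC

/-!
The two regions are compared through two facts, which together give both directions.

* `BMAC.sum_log_mem_rateRegion`: the sums `∑ m, log (1 + γ l m)` of the stream rates of an achievable
  SINR vector `γ` form an achievable rate vector. By Cauchy–Schwarz no unit receive vector beats the
  SINR `b† Q⁻¹ b` of the MMSE receiver, where `b` is the received signal of a stream and `Q` the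
  covariance of what it sees, and by the matrix determinant lemma the factors `1 + b† Q⁻¹ b` of the
  streams of a link, decoded successively, multiply up to `det (I + H Σ H† Ω⁻¹)`.
* `BMAC.exists_mem_sinrRegion_ge`: above the equal-SINR point of every achievable rate vector lies an
  achievable SINR vector. First `BMAC.exists_rank_reduction` replaces each covariance by a smaller one
  with at most `rank H_{l,l}` streams and the same desired signal. Then `BMAC.exists_equal_split`
  rotates these streams so that they all have the same SINR: the required value `d` of `1 + b† Q⁻¹ b`
  is the geometric mean of the eigenvalues of `I + B† Ω⁻¹ B`, hence lies in its numerical range,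
  which gives the last stream; the others follow by induction with that stream added to the noise.
  The SINRs may exceed their targets, since the other links have reduced their interference.

If the equal-SINR point of `I` is Pareto-optimal, `I` is achievable by the first fact, and by the second
an achievable rate vector above `I` gives an SINR vector above the equal-SINR point. If `I` is
Pareto-optimal, an achievable SINR vector above the equal-SINR point has stream rates summing to at
least `I l` on each link `l`, hence to exactly `I l`, so it is the equal-SINR point itself; the second
fact provides such a vector.
-/

namespace BMAC

/-! ### Rank-one matrices and quadratic forms -/

theorem star_dotProduct_vecMulVec_mulVec {n : Type*} [Fintype n] (x r : n → ℂ) :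
    star r ⬝ᵥ (vecMulVec x (star x) *ᵥ r) = ((‖star r ⬝ᵥ x‖ ^ 2 : ℝ) : ℂ) := by
  have h : star x ⬝ᵥ r = star (star r ⬝ᵥ x) := by rw [star_dotProduct]
  rw [vecMulVec_mulVec, h, dotProduct_smul, op_smul_eq_smul, smul_eq_mul]
  push_cast
  rw [← Complex.conj_mul']
  rfl

theorem mul_vecMulVec_star_mul_conjTranspose {m n : Type*} [Fintype n]
    (A : Matrix m n ℂ) (x : n → ℂ) :
    A * vecMulVec x (star x) * Aᴴ = vecMulVec (A *ᵥ x) (star (A *ᵥ x)) := by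
  rw [mul_vecMulVec, vecMulVec_mul, star_mulVec]

theorem star_dotProduct_conj_mulVec {m n : Type*} [Fintype m] [Fintype n]
    (A : Matrix m n ℂ) (Q : Matrix m m ℂ) (x : n → ℂ) :
    star x ⬝ᵥ ((Aᴴ * Q * A) *ᵥ x) = star (A *ᵥ x) ⬝ᵥ (Q *ᵥ (A *ᵥ x)) := by
  rw [star_mulVec, ← dotProduct_mulVec, mulVec_mulVec, mulVec_mulVec, Matrix.mul_assoc]

/-- Cauchy–Schwarz for the inner product given by a positive definite matrix `Q`, in its dual
form. Equality holds for `r = Q⁻¹ b`, so the right factor is the largest SINR which a receive vector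
can extract from the signal `b` in noise of covariance `Q`. -/
theorem norm_sq_dotProduct_le {n : Type*} [Fintype n] [DecidableEq n] {Q : Matrix n n ℂ}
    (hQ : Q.PosDef) (r b : n → ℂ) :
    ‖star r ⬝ᵥ b‖ ^ 2 ≤ (star r ⬝ᵥ (Q *ᵥ r)).re * (star b ⬝ᵥ (Q⁻¹ *ᵥ b)).re := by
  have hdet : IsUnit Q.det := (Matrix.isUnit_iff_isUnit_det Q).1 hQ.isUnit
  obtain ⟨x, hx⟩ : ∃ x, x = Q⁻¹ *ᵥ b := ⟨_, rfl⟩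
  have hb : b = Q *ᵥ x := by rw [hx, mulVec_mulVec, mul_nonsing_inv _ hdet, one_mulVec]
  obtain ⟨C, hC⟩ : ∃ C : Matrix n n ℂ, Q = Cᴴ * C := by
    open scoped MatrixOrder in
    exact CStarAlgebra.nonneg_iff_eq_star_mul_self.1 hQ.posSemidef.nonneg
  have key : ∀ u v : n → ℂ, star u ⬝ᵥ (Q *ᵥ v) =
      inner ℂ (WithLp.toLp 2 (C *ᵥ u)) (WithLp.toLp 2 (C *ᵥ v)) := by
    intro u v
    rw [EuclideanSpace.inner_toLp_toLp, dotProduct_comm (C *ᵥ v), hC, star_mulVec,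
      ← dotProduct_mulVec, mulVec_mulVec]
  have hbx : star b ⬝ᵥ x = star x ⬝ᵥ (Q *ᵥ x) := by
    conv_lhs => rw [hb]
    rw [star_mulVec, hQ.isHermitian.eq, dotProduct_mulVec]
  rw [← hx, hbx]
  conv_lhs => rw [hb]
  have h2 : ∀ u : n → ℂ, (star u ⬝ᵥ (Q *ᵥ u)).re = ‖WithLp.toLp 2 (C *ᵥ u)‖ ^ 2 := by
    intro u
    rw [key, inner_self_eq_norm_sq_to_K]
    norm_cast
  rw [key, h2, h2, ← mul_pow]
  gcongr
  exact norm_inner_le_norm _ _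

theorem det_add_vecMulVec_star {n : Type*} [Fintype n] [DecidableEq n] {Q : Matrix n n ℂ}
    (hQ : Q.PosDef) (b : n → ℂ) :
    (Q + vecMulVec b (star b)).det = Q.det * (1 + star b ⬝ᵥ (Q⁻¹ *ᵥ b)) := by
  have hdet : IsUnit Q.det := (Matrix.isUnit_iff_isUnit_det Q).1 hQ.isUnit
  rw [vecMulVec_eq Unit, det_add_replicateCol_mul_replicateRow hdet, Matrix.mul_assoc,
    ← replicateCol_mulVec, det_unique (n := Unit), Matrix.add_apply, Matrix.one_apply_eq,
    replicateRow_mul_replicateCol_apply]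

theorem ofReal_re_star_dotProduct_mulVec {n : Type*} [Fintype n] {Q : Matrix n n ℂ}
    (hQ : Q.PosSemidef) (b : n → ℂ) :
    (((star b ⬝ᵥ (Q *ᵥ b)).re : ℝ) : ℂ) = star b ⬝ᵥ (Q *ᵥ b) := by
  have := hQ.dotProduct_mulVec_nonneg b
  exact (Complex.eq_re_of_ofReal_le (r := 0) (by simpa using this)).symm

theorem sum_vecMulVec_orthonormalBasis {n : ℕ}
    (b : OrthonormalBasis (Fin n) ℂ (EuclideanSpace ℂ (Fin n))) :
    ∑ i, vecMulVec (b i).ofLp (star (b i).ofLp) = 1 := by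
  ext i j
  have := b.sum_inner_mul_inner (EuclideanSpace.single i 1) (EuclideanSpace.single j 1)
  simp [EuclideanSpace.inner_single_left, EuclideanSpace.inner_single_right] at this
  simp [Matrix.sum_apply, vecMulVec_apply, this, Matrix.one_apply, eq_comm]

/-- Mixing the columns of `W` by a unitary matrix does not change `W * Wᴴ`. -/
theorem sum_vecMulVec_mulVec_orthonormalBasis {m : Type*} {n : ℕ} (W : Matrix m (Fin n) ℂ)
    (b : OrthonormalBasis (Fin n) ℂ (EuclideanSpace ℂ (Fin n))) :
    ∑ i, vecMulVec (W *ᵥ (b i).ofLp) (star (W *ᵥ (b i).ofLp)) = W * Wᴴ := by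
  simp_rw [← mul_vecMulVec_star_mul_conjTranspose]
  rw [← Matrix.sum_mul, ← Matrix.mul_sum, sum_vecMulVec_orthonormalBasis, Matrix.mul_one]

theorem sum_vecMulVec_col {m n : Type*} [Fintype n] (W : Matrix m n ℂ) :
    ∑ i, vecMulVec (W.col i) (star (W.col i)) = W * Wᴴ := by
  ext i j
  simp [Matrix.sum_apply, vecMulVec_apply, Matrix.mul_apply]

/-! ### Splitting a covariance into streams of equal SINR -/

/-- The smallest eigenvalue of a positive definite matrix is at most the geometric mean `d` of
all eigenvalues and the largest is at least `d`, so `d` lies in the numerical range. -/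
theorem exists_unit_quadForm_eq {n : ℕ} {G : Matrix (Fin (n + 1)) (Fin (n + 1)) ℂ}
    (hG : G.PosDef) {d : ℝ} (hd : 0 < d) (hdet : G.det = ((d ^ (n + 1) : ℝ) : ℂ)) :
    ∃ v : EuclideanSpace ℂ (Fin (n + 1)), ‖v‖ = 1 ∧ star v.ofLp ⬝ᵥ (G *ᵥ v.ofLp) = d := by
  set ev := hG.isHermitian.eigenvalues with hev
  have hpos : ∀ i, 0 < ev i := hG.eigenvalues_pos
  have hprod : ∏ i, ev i = ∏ _i : Fin (n + 1), d := by
    rw [hG.isHermitian.det_eq_prod_eigenvalues] at hdet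
    rw [Finset.prod_const, Finset.card_univ, Fintype.card_fin]
    refine Complex.ofReal_injective (Eq.trans ?_ hdet)
    exact Complex.ofReal_prod _ _
  obtain ⟨i, hi⟩ : ∃ i, ev i ≤ d := by
    by_contra! h
    exact (Finset.prod_lt_prod_of_nonempty (fun _ _ => hd) (fun i _ => h i)
      Finset.univ_nonempty).ne' hprod
  obtain ⟨j, hj⟩ : ∃ j, d ≤ ev j := by
    by_contra! h
    exact (Finset.prod_lt_prod_of_nonempty (fun i _ => hpos i) (fun i _ => h i)
      Finset.univ_nonempty).ne hprod
  obtain ⟨c₁, c₂, h₁, h₂, h12, hc⟩ : d ∈ segment ℝ (ev i) (ev j) := by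
    rw [segment_eq_Icc (hi.trans hj)]; exact ⟨hi, hj⟩
  let w : Fin (n + 1) → ℝ := fun k => (if k = i then c₁ else 0) + (if k = j then c₂ else 0)
  have hw : ∀ k, 0 ≤ w k := fun k => by positivity
  let y : Fin (n + 1) → ℂ := fun k => (Real.sqrt (w k) : ℂ)
  have hy : ∀ k, star (y k) * y k = (w k : ℂ) := by
    intro k
    simp only [y, Complex.star_def, Complex.conj_ofReal]
    rw [← Complex.ofReal_mul, Real.mul_self_sqrt (hw k)]
  let U : Matrix (Fin (n + 1)) (Fin (n + 1)) ℂ := hG.isHermitian.eigenvectorUnitary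
  have hUU : Uᴴ * U = 1 := Unitary.coe_star_mul_self hG.isHermitian.eigenvectorUnitary
  have hUG : Uᴴ * G * U = diagonal (fun k => (ev k : ℂ)) := by
    have := hG.isHermitian.conjStarAlgAut_star_eigenvectorUnitary
    rw [Unitary.conjStarAlgAut_star_apply] at this
    exact this
  refine ⟨WithLp.toLp 2 (U *ᵥ y), ?_, ?_⟩
  · have h : ‖WithLp.toLp 2 (U *ᵥ y)‖ ^ 2 = 1 := by
      have h1 : ((‖WithLp.toLp 2 (U *ᵥ y)‖ ^ 2 : ℝ) : ℂ) = 1 := by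
        have h3 := star_dotProduct_conj_mulVec U 1 y
        rw [Matrix.mul_one, hUU, one_mulVec, one_mulVec] at h3
        push_cast
        have h4 := inner_self_eq_norm_sq_to_K (𝕜 := ℂ) (WithLp.toLp 2 (U *ᵥ y))
        rw [EuclideanSpace.inner_toLp_toLp, dotProduct_comm, ← h3] at h4
        refine h4.symm.trans ?_
        simp only [dotProduct, Pi.star_apply, hy, w]
        rw [← Complex.ofReal_sum]
        simp [Finset.sum_add_distrib, h12, -Complex.ofReal_add]
      exact_mod_cast h1
    nlinarith [norm_nonneg (WithLp.toLp 2 (U *ᵥ y))]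
  · rw [← star_dotProduct_conj_mulVec, hUG]
    have : ∀ k, star (y k) * ((ev k : ℂ) * y k) = (ev k * w k : ℝ) := by
      intro k
      push_cast
      rw [← hy]; ring
    simp only [dotProduct, mulVec_diagonal, Pi.star_apply, this, w]
    rw [← hc, ← Complex.ofReal_sum]
    simp [mul_add, Finset.sum_add_distrib]
    ring

/-- The covariance of what stream `m` sees when the streams `b` are decoded in increasing order
over a background of covariance `Ω`: only the later streams are still present. -/
noncomputable def sicCov {ι : Type*} {n : ℕ} (Ω : Matrix ι ι ℂ) (b : Fin n → ι → ℂ) (m : Fin n) :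
    Matrix ι ι ℂ :=
  Ω + ∑ j, if m < j then vecMulVec (b j) (star (b j)) else 0

theorem sicCov_posDef {ι : Type*} [Fintype ι] {n : ℕ} {Ω : Matrix ι ι ℂ} (hΩ : Ω.PosDef)
    (b : Fin n → ι → ℂ) (m : Fin n) : (sicCov Ω b m).PosDef := by
  refine hΩ.add_posSemidef (posSemidef_sum _ fun j _ => ?_)
  split_ifs
  · exact posSemidef_vecMulVec_self_star _
  · exact .zero

theorem sicCov_last {ι : Type*} {n : ℕ} (Ω : Matrix ι ι ℂ) (b : Fin (n + 1) → ι → ℂ) :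
    sicCov Ω b (Fin.last n) = Ω := by
  simp [sicCov, (Fin.le_last _).not_gt]

/-- For every earlier stream, the last stream is part of the background. -/
theorem sicCov_castSucc {ι : Type*} {n : ℕ} (Ω : Matrix ι ι ℂ) (b : Fin (n + 1) → ι → ℂ)
    (m : Fin n) :
    sicCov Ω b m.castSucc =
      sicCov (Ω + vecMulVec (b (Fin.last n)) (star (b (Fin.last n))))
        (fun i => b i.castSucc) m := by
  simp only [sicCov, Fin.sum_univ_castSucc, Fin.castSucc_lt_castSucc_iff, Fin.castSucc_lt_last,
    if_true]
  abel

/-- Successive cancellation with optimal receivers loses nothing: the stream rates add up to the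
rate of the whole link. -/
theorem det_add_sum_vecMulVec {ι : Type*} [Fintype ι] [DecidableEq ι] {n : ℕ} {Ω : Matrix ι ι ℂ}
    (hΩ : Ω.PosDef) (b : Fin n → ι → ℂ) :
    (Ω + ∑ i, vecMulVec (b i) (star (b i))).det =
      Ω.det * ∏ m, (1 + star (b m) ⬝ᵥ ((sicCov Ω b m)⁻¹ *ᵥ b m)) := by
  induction n generalizing Ω with
  | zero => simp
  | succ n ih =>
    rw [Fin.prod_univ_castSucc, sicCov_last, Fin.sum_univ_castSucc,
      add_comm (∑ i : Fin n, _), ← add_assoc,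
      ih (hΩ.add_posSemidef (posSemidef_vecMulVec_self_star _)) fun i => b i.castSucc,
      det_add_vecMulVec_star hΩ]
    simp_rw [sicCov_castSucc]
    ring

/-- The streams of a covariance can be rotated so that all of them get the same SINR `d - 1`,
where `d` is the geometric mean forced by `det_add_sum_vecMulVec`. The last stream is a unit
mixture at which the quadratic form `1 + Bᴴ * Ω⁻¹ * B` takes the value `d`; it then joins the
background, and the remaining streams are rotated among themselves. -/
theorem exists_equal_split {ι κ : Type*} [Fintype ι] [DecidableEq ι] [Fintype κ]
    (A : Matrix ι κ ℂ) {d : ℝ} (hd : 0 < d) {n : ℕ} (u : Fin n → κ → ℂ) {Ω : Matrix ι ι ℂ}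
    (hΩ : Ω.PosDef)
    (hdet : (Ω + A * (∑ i, vecMulVec (u i) (star (u i))) * Aᴴ).det = ((d ^ n : ℝ) : ℂ) * Ω.det) :
    ∃ t : Fin n → κ → ℂ,
      ∑ i, vecMulVec (t i) (star (t i)) = ∑ i, vecMulVec (u i) (star (u i)) ∧
      ∀ m, star (A *ᵥ t m) ⬝ᵥ ((sicCov Ω (fun i => A *ᵥ t i) m)⁻¹ *ᵥ (A *ᵥ t m)) = d - 1 := by
  induction n generalizing Ω with
  | zero => exact ⟨u, rfl, fun m => m.elim0⟩
  | succ n ih =>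
    let W : Matrix κ (Fin (n + 1)) ℂ := (Matrix.of u)ᵀ
    have hW : ∑ i, vecMulVec (u i) (star (u i)) = W * Wᴴ := sum_vecMulVec_col W
    have hΩdet : IsUnit Ω.det := (Matrix.isUnit_iff_isUnit_det Ω).1 hΩ.isUnit
    let B := A * W
    let G := 1 + Bᴴ * Ω⁻¹ * B
    have hG : G.PosDef :=
      PosDef.one.add_posSemidef (hΩ.inv.posSemidef.conjTranspose_mul_mul_same B)
    have hGdet : G.det = ((d ^ (n + 1) : ℝ) : ℂ) := by
      have h : A * (W * Wᴴ) * Aᴴ = B * Bᴴ := by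
        simp only [B, conjTranspose_mul, Matrix.mul_assoc]
      rw [hW, h, det_add_mul _ _ hΩdet, mul_comm] at hdet
      exact mul_right_cancel₀ hΩdet.ne_zero hdet
    obtain ⟨v, hv, hvG⟩ := exists_unit_quadForm_eq hG hd hGdet
    obtain ⟨e, he⟩ := Orthonormal.exists_orthonormalBasis_extension_of_card_eq
      (𝕜 := ℂ) (E := EuclideanSpace ℂ (Fin (n + 1))) (by simp) (v := fun _ => v)
      (s := {Fin.last n}) (by
        rw [orthonormal_iff_ite]
        rintro ⟨i, rfl⟩ ⟨j, rfl⟩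
        simp [inner_self_eq_norm_sq_to_K, hv])
    replace he : e (Fin.last n) = v := he _ rfl
    let w : Fin (n + 1) → κ → ℂ := fun i => W *ᵥ (e i).ofLp
    have hw : ∑ i, vecMulVec (w i) (star (w i)) = ∑ i, vecMulVec (u i) (star (u i)) := by
      rw [hW]; exact sum_vecMulVec_mulVec_orthonormalBasis W e
    let s := w (Fin.last n)
    have hs : star (A *ᵥ s) ⬝ᵥ (Ω⁻¹ *ᵥ (A *ᵥ s)) = d - 1 := by
      have h1 : A *ᵥ s = B *ᵥ v.ofLp := by
        simp only [s, w, he, B, mulVec_mulVec]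
      have h2 : star v.ofLp ⬝ᵥ v.ofLp = 1 := by
        have := inner_self_eq_norm_sq_to_K (𝕜 := ℂ) v
        rw [EuclideanSpace.inner_eq_star_dotProduct, dotProduct_comm, hv] at this
        simpa using this
      rw [h1, ← star_dotProduct_conj_mulVec]
      simp only [G, add_mulVec, one_mulVec, dotProduct_add, h2] at hvG
      rw [← hvG]; ring
    have hΩ' : (Ω + vecMulVec (A *ᵥ s) (star (A *ᵥ s))).PosDef :=
      hΩ.add_posSemidef (posSemidef_vecMulVec_self_star _)
    obtain ⟨t, ht, htm⟩ := ih (fun i => w i.castSucc) hΩ' (by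
      rw [det_add_vecMulVec_star hΩ, hs]
      rw [← hw, Fin.sum_univ_castSucc, Matrix.mul_add, Matrix.add_mul,
        mul_vecMulVec_star_mul_conjTranspose, add_comm (A * _ * _), ← add_assoc] at hdet
      rw [hdet]
      push_cast
      ring)
    refine ⟨Fin.snoc t s, ?_, fun m => ?_⟩
    · rw [← hw, Fin.sum_univ_castSucc, Fin.sum_univ_castSucc]
      simp [ht, s]
    · induction m using Fin.lastCases with
      | last => simpa [sicCov_last] using hs
      | cast m => simpa [sicCov_castSucc] using htm m

/-! ### Rank reduction of a covariance -/

/-- A covariance `S` can be replaced by a smaller one which carries at most `A.rank` streams and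
looks the same through the channel `A`. With `S = C * Cᴴ`, the streams are the images under `C` of
the eigenvectors of `(A * C)ᴴ * (A * C)` with nonzero eigenvalue. -/
theorem exists_rank_reduction {ι : Type*} [Fintype ι] {a : ℕ}
    (A : Matrix ι (Fin a) ℂ) {S : Matrix (Fin a) (Fin a) ℂ} (hS : S.PosSemidef) :
    ∃ u : Fin A.rank → Fin a → ℂ, (S - ∑ i, vecMulVec (u i) (star (u i))).PosSemidef ∧
      A * (∑ i, vecMulVec (u i) (star (u i))) * Aᴴ = A * S * Aᴴ := by
  obtain ⟨C, hC⟩ : ∃ C : Matrix (Fin a) (Fin a) ℂ, S = C * Cᴴ := by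
    open scoped MatrixOrder in
    exact CStarAlgebra.nonneg_iff_eq_mul_star_self.1 hS.nonneg
  let B := A * C
  have hB : (Bᴴ * B).IsHermitian := isHermitian_conjTranspose_mul_self B
  let e := hB.eigenvectorBasis
  have hker : ∀ i, hB.eigenvalues i = 0 → B *ᵥ (e i).ofLp = 0 := by
    intro i hi
    have h := hB.mulVec_eigenvectorBasis i
    rw [hi, zero_smul] at h
    exact conjTranspose_mul_self_mulVec_eq_zero B _ |>.1 h
  have hcard : Fintype.card {i // hB.eigenvalues i ≠ 0} ≤ Fintype.card (Fin A.rank) := by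
    rw [← hB.rank_eq_card_non_zero_eigs, rank_conjTranspose_mul_self, Fintype.card_fin]
    exact rank_mul_le_left A C
  obtain ⟨f⟩ := Function.Embedding.nonempty_of_card_le hcard
  let g : {i // hB.eigenvalues i ≠ 0} → Fin a → ℂ := fun i => C *ᵥ (e i).ofLp
  have hsum : ∑ i, vecMulVec (Function.extend f g 0 i) (star (Function.extend f g 0 i)) =
      ∑ i : {i // hB.eigenvalues i ≠ 0}, vecMulVec (g i) (star (g i)) := by
    symm
    apply Finset.sum_of_injOn f f.injective.injOn (by simp)
    · intro i _ hi
      rw [Function.extend_apply' _ _ _ (by simpa using hi)]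
      simp
    · intro i _
      rw [f.injective.extend_apply]
  have hsplit : S = ∑ i : {i // hB.eigenvalues i ≠ 0}, vecMulVec (g i) (star (g i)) +
      ∑ i : {i // ¬ hB.eigenvalues i ≠ 0},
        vecMulVec (C *ᵥ (e i).ofLp) (star (C *ᵥ (e i).ofLp)) := by
    rw [hC, ← sum_vecMulVec_mulVec_orthonormalBasis C e]
    exact (Fintype.sum_subtype_add_sum_subtype (fun i => hB.eigenvalues i ≠ 0) _).symm
  refine ⟨Function.extend f g 0, ?_, ?_⟩ <;> rw [hsum]
  · rw [hsplit, add_sub_cancel_left]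
    exact posSemidef_sum _ fun i _ => posSemidef_vecMulVec_self_star _
  · conv_rhs => rw [hsplit, Matrix.mul_add, Matrix.add_mul]
    rw [left_eq_add, Matrix.mul_sum, Matrix.sum_mul]
    refine Finset.sum_eq_zero fun i _ => ?_
    rw [mul_vecMulVec_star_mul_conjTranspose, mulVec_mulVec]
    have : (A * C) *ᵥ (e i).ofLp = 0 := hker i (not_not.1 i.2)
    rw [this]
    simp

variable {L : ℕ} {tx rx : Fin L → ℕ} {M : Fin L → ℕ}

/-! ### Rates and SINRs in terms of stream vectors -/

/-- The covariance `∑ n, s_{k,n} s_{k,n}†` which link `k` transmits when its streams are sent along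
the vectors `s k n`, scaled by the square roots of their powers. -/
noncomputable def streamCov (s : ∀ l : Fin L, Fin (M l) → Fin (tx l) → ℂ) (k : Fin L) :
    Matrix (Fin (tx k)) (Fin (tx k)) ℂ :=
  ∑ n, vecMulVec (s k n) (star (s k n))

theorem streamCov_posSemidef (s : ∀ l : Fin L, Fin (M l) → Fin (tx l) → ℂ) (k : Fin L) :
    (streamCov s k).PosSemidef :=
  posSemidef_sum _ fun _ _ => posSemidef_vecMulVec_self_star _

theorem mul_streamCov_mul_conjTranspose {a : ℕ} (s : ∀ l : Fin L, Fin (M l) → Fin (tx l) → ℂ)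
    (k : Fin L) (A : Matrix (Fin a) (Fin (tx k)) ℂ) :
    A * streamCov s k * Aᴴ = ∑ n, vecMulVec (A *ᵥ s k n) (star (A *ᵥ s k n)) := by
  simp_rw [streamCov, Matrix.mul_sum, Matrix.sum_mul, mul_vecMulVec_star_mul_conjTranspose]

section

variable {H : ∀ l k : Fin L, Matrix (Fin (rx l)) (Fin (tx k)) ℂ} {Φ : Matrix (Fin L) (Fin L) ℝ}

theorem interferenceCov_posDef (hΦ : ∀ l k, 0 ≤ Φ l k)
    {S : ∀ k : Fin L, Matrix (Fin (tx k)) (Fin (tx k)) ℂ} (hS : ∀ k, (S k).PosSemidef) (l : Fin L) :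
    (interferenceCov H Φ S l).PosDef :=
  PosDef.one.add_posSemidef <| posSemidef_sum _ fun k _ =>
    ((hS k).mul_mul_conjTranspose_same (H l k)).smul (by exact_mod_cast hΦ l k)

theorem interferenceCov_sub_posSemidef (hΦ : ∀ l k, 0 ≤ Φ l k)
    {S S' : ∀ k : Fin L, Matrix (Fin (tx k)) (Fin (tx k)) ℂ}
    (hS : ∀ k, (S k - S' k).PosSemidef) (l : Fin L) :
    (interferenceCov H Φ S l - interferenceCov H Φ S' l).PosSemidef := by
  have h : interferenceCov H Φ S l - interferenceCov H Φ S' l =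
      ∑ k, (Φ l k : ℂ) • (H l k * (S k - S' k) * (H l k)ᴴ) := by
    simp only [interferenceCov, add_sub_add_left_eq_sub, ← Finset.sum_sub_distrib, ← smul_sub,
      Matrix.mul_sub, Matrix.sub_mul]
  rw [h]
  exact posSemidef_sum _ fun k _ =>
    ((hS k).mul_mul_conjTranspose_same (H l k)).smul (by exact_mod_cast hΦ l k)

theorem exp_rate_mul_det (hΦ : ∀ l k, 0 ≤ Φ l k)
    {S : ∀ k : Fin L, Matrix (Fin (tx k)) (Fin (tx k)) ℂ} (hS : ∀ k, (S k).PosSemidef) (l : Fin L) :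
    (interferenceCov H Φ S l + H l l * S l * (H l l)ᴴ).det =
      (Real.exp (rate H Φ S l) : ℂ) * (interferenceCov H Φ S l).det := by
  have hΩ := interferenceCov_posDef (H := H) hΦ hS l
  have hX := hΩ.add_posSemidef ((hS l).mul_mul_conjTranspose_same (H l l))
  rw [rate]
  set Ω := interferenceCov H Φ S l
  set X := H l l * S l * (H l l)ᴴ
  have hdet : IsUnit Ω.det := (Matrix.isUnit_iff_isUnit_det Ω).1 hΩ.isUnit
  have h1 : (Ω + X).det = (1 + X * Ω⁻¹).det * Ω.det := by
    rw [← det_mul, Matrix.add_mul, Matrix.one_mul, Matrix.mul_assoc, nonsing_inv_mul _ hdet,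
      Matrix.mul_one]
  have h2 : 0 < (1 + X * Ω⁻¹).det := by
    have h3 : (1 + X * Ω⁻¹).det = (Ω + X).det * Ω⁻¹.det := by
      rw [h1, mul_assoc, ← det_mul, mul_nonsing_inv _ hdet, det_one, mul_one]
    rw [h3]
    exact mul_pos hX.det_pos hΩ.inv.det_pos
  rw [Complex.lt_def] at h2
  rw [h1, Real.exp_log h2.1]
  congr 1
  exact Complex.ext rfl h2.2.symm

/-- The SINR of a stream is a generalized Rayleigh quotient of its receive vector: the noise is what
successive cancellation leaves over the interference from the other links. -/
theorem sinr_eq_div (hΦdiag : ∀ l, Φ l l = 0)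
    {T : ∀ l : Fin L, Fin (M l) → EuclideanSpace ℂ (Fin (tx l))}
    {R : ∀ l : Fin L, Fin (M l) → EuclideanSpace ℂ (Fin (rx l))}
    {p : ∀ l : Fin L, Fin (M l) → ℝ} (hR : ∀ l m, ‖R l m‖ = 1) (hp : ∀ l m, 0 ≤ p l m)
    {s : ∀ l : Fin L, Fin (M l) → Fin (tx l) → ℂ}
    (hs : ∀ l m, s l m = (√(p l m) : ℂ) • (T l m).ofLp) (l : Fin L) (m : Fin (M l)) :
    sinr H Φ T R p l m = ‖star (R l m).ofLp ⬝ᵥ (H l l *ᵥ s l m)‖ ^ 2 /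
      (star (R l m).ofLp ⬝ᵥ (sicCov (interferenceCov H Φ (streamCov s) l)
        (fun n => H l l *ᵥ s l n) m *ᵥ (R l m).ofLp)).re := by
  have hgain : ∀ k n, p k n * gain (H l k) (R l m) (T k n) =
      ‖star (R l m).ofLp ⬝ᵥ (H l k *ᵥ s k n)‖ ^ 2 := by
    intro k n
    rw [gain, hs, mulVec_smul, dotProduct_smul, norm_smul, mul_pow, Complex.norm_real,
      Real.norm_of_nonneg (Real.sqrt_nonneg _), Real.sq_sqrt (hp k n)]
  have hone : star (R l m).ofLp ⬝ᵥ (R l m).ofLp = 1 := by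
    have := inner_self_eq_norm_sq_to_K (𝕜 := ℂ) (R l m)
    rw [EuclideanSpace.inner_eq_star_dotProduct, dotProduct_comm, hR] at this
    simpa using this
  rw [sinr, hgain]
  congr 1
  set r := (R l m).ofLp
  have hΩ : (star r ⬝ᵥ (interferenceCov H Φ (streamCov s) l *ᵥ r)).re =
      1 + ∑ k, Φ l k * ∑ n, ‖star r ⬝ᵥ (H l k *ᵥ s k n)‖ ^ 2 := by
    simp only [interferenceCov, mul_streamCov_mul_conjTranspose, add_mulVec, one_mulVec,
      dotProduct_add, hone, sum_mulVec, dotProduct_sum, smul_mulVec, dotProduct_smul,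
      star_dotProduct_vecMulVec_mulVec, smul_eq_mul, ← Complex.ofReal_sum, ← Complex.ofReal_mul,
      Complex.add_re, Complex.one_re, Complex.ofReal_re]
  have hlater : (star r ⬝ᵥ ((∑ n, if m < n then
      vecMulVec (H l l *ᵥ s l n) (star (H l l *ᵥ s l n)) else 0) *ᵥ r)).re =
      ∑ n, p l n * crossTalk H Φ T R l m l n := by
    rw [sum_mulVec, dotProduct_sum, Complex.re_sum]
    refine Finset.sum_congr rfl fun n _ => ?_
    simp only [crossTalk, if_true, Fin.val_fin_lt]
    split_ifs
    · rw [star_dotProduct_vecMulVec_mulVec, Complex.ofReal_re, hgain]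
    · simp
  rw [sicCov, add_mulVec, dotProduct_add, Complex.add_re, hΩ, hlater, add_assoc,
    ← Finset.add_sum_erase _ _ (Finset.mem_univ l),
    ← Finset.add_sum_erase _ (fun k => Φ l k * _) (Finset.mem_univ l), hΦdiag, zero_mul, zero_add,
    add_comm (∑ n, _)]
  congr 2
  refine Finset.sum_congr rfl fun k hk => ?_
  rw [Finset.mul_sum]
  refine Finset.sum_congr rfl fun n _ => ?_
  rw [crossTalk, if_neg (Finset.ne_of_mem_erase hk), ← hgain]
  ring

end

theorem re_trace_vecMulVec_star {a : ℕ} (x : Fin a → ℂ) :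
    (trace (vecMulVec x (star x))).re = ‖WithLp.toLp 2 x‖ ^ 2 := by
  have := inner_self_eq_norm_sq_to_K (𝕜 := ℂ) (WithLp.toLp 2 x)
  rw [EuclideanSpace.inner_toLp_toLp] at this
  rw [trace_vecMulVec, this]
  norm_cast

theorem exists_unit_eq_norm_smul {a : ℕ} (ha : 0 < a) (x : Fin a → ℂ) :
    ∃ e : EuclideanSpace ℂ (Fin a), ‖e‖ = 1 ∧ x = (‖WithLp.toLp 2 x‖ : ℂ) • e.ofLp := by
  by_cases hx : WithLp.toLp 2 x = 0
  · refine ⟨EuclideanSpace.single ⟨0, ha⟩ 1, by simp, ?_⟩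
    rw [hx]
    simpa using hx
  · have hn : (‖WithLp.toLp 2 x‖ : ℂ) ≠ 0 := by simpa using hx
    refine ⟨(‖WithLp.toLp 2 x‖ : ℂ)⁻¹ • WithLp.toLp 2 x, ?_, ?_⟩
    · exact norm_smul_inv_norm hx
    · rw [WithLp.ofLp_smul, smul_inv_smul₀ hn]

/-- The unit vector in direction `Q⁻¹ b` is an optimal receive vector: it attains the bound of
`norm_sq_dotProduct_le`. -/
theorem exists_unit_mmse_receiver {a : ℕ} (ha : 0 < a) {Q : Matrix (Fin a) (Fin a) ℂ}
    (hQ : Q.PosDef) (b : Fin a → ℂ) :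
    ∃ e : EuclideanSpace ℂ (Fin a), ‖e‖ = 1 ∧
      (star b ⬝ᵥ (Q⁻¹ *ᵥ b)).re * (star e.ofLp ⬝ᵥ (Q *ᵥ e.ofLp)).re ≤ ‖star e.ofLp ⬝ᵥ b‖ ^ 2 := by
  have hdet : IsUnit Q.det := (Matrix.isUnit_iff_isUnit_det Q).1 hQ.isUnit
  obtain ⟨x, hx⟩ : ∃ x, x = Q⁻¹ *ᵥ b := ⟨_, rfl⟩
  have hb : b = Q *ᵥ x := by rw [hx, mulVec_mulVec, mul_nonsing_inv _ hdet, one_mulVec]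
  obtain ⟨e, he, hxe⟩ := exists_unit_eq_norm_smul ha x
  set c := ‖WithLp.toLp 2 x‖
  refine ⟨e, he, ?_⟩
  have hbx : star b ⬝ᵥ x = star x ⬝ᵥ (Q *ᵥ x) := by
    conv_lhs => rw [hb]
    rw [star_mulVec, hQ.isHermitian.eq, dotProduct_mulVec]
  have hre := ofReal_re_star_dotProduct_mulVec hQ.posSemidef e.ofLp
  have h1 : (star b ⬝ᵥ x).re = c ^ 2 * (star e.ofLp ⬝ᵥ (Q *ᵥ e.ofLp)).re := by
    rw [hbx, hxe, mulVec_smul, dotProduct_smul, star_smul, smul_dotProduct, ← hre]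
    simp [pow_two, mul_assoc]
  have h2 : ‖star e.ofLp ⬝ᵥ b‖ ^ 2 = c ^ 2 * (star e.ofLp ⬝ᵥ (Q *ᵥ e.ofLp)).re ^ 2 := by
    rw [hb, hxe, mulVec_smul, dotProduct_smul, ← hre, norm_smul, mul_pow]
    simp
  rw [← hx, h1, h2]
  exact le_of_eq (by ring)

theorem matrix_eq_zero_of_rank_eq_zero {m n : Type*} [Fintype m] [Fintype n] {A : Matrix m n ℂ}
    (h : A.rank = 0) : A = 0 := by
  classical
  rw [rank, Submodule.finrank_eq_zero, LinearMap.range_eq_bot] at h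
  refine ext_of_mulVec_single fun i => ?_
  rw [zero_mulVec]
  exact LinearMap.congr_fun h (Pi.single i 1)

/-! ### Comparison of the two regions -/

section

variable {H : ∀ l k : Fin L, Matrix (Fin (rx l)) (Fin (tx k)) ℂ} {Φ : Matrix (Fin L) (Fin L) ℝ}

/-- The sums of the stream rates of an achievable SINR vector form an achievable rate vector. -/
theorem sum_log_mem_rateRegion (hΦ : ∀ l k, 0 ≤ Φ l k) (hΦdiag : ∀ l, Φ l l = 0) {P : ℝ}
    {γ : ∀ l : Fin L, Fin (M l) → ℝ} (hγ : γ ∈ sinrRegion H Φ M P) :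
    (∀ l m, 0 ≤ γ l m) ∧ (fun l => ∑ m, Real.log (1 + γ l m)) ∈ rateRegion H Φ P := by
  obtain ⟨T, R, p, hT, hR, hp, hP, hγ⟩ := hγ
  let s : ∀ l : Fin L, Fin (M l) → Fin (tx l) → ℂ := fun l m => (√(p l m) : ℂ) • (T l m).ofLp
  have hS := streamCov_posSemidef s
  have hΩ : ∀ l, (interferenceCov H Φ (streamCov s) l).PosDef := interferenceCov_posDef hΦ hS
  have hQ : ∀ l m, (sicCov (interferenceCov H Φ (streamCov s) l)
      (fun n => H l l *ᵥ s l n) m).PosDef := fun l m => sicCov_posDef (hΩ l) _ m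
  have hsinr : ∀ l m, γ l m = _ := fun l m =>
    (hγ l m).trans (sinr_eq_div hΦdiag hR hp (s := s) (fun _ _ => rfl) l m)
  have hpos : ∀ l m, 0 ≤ γ l m := by
    intro l m
    rw [hsinr]
    exact div_nonneg (by positivity) ((hQ l m).posSemidef.re_dotProduct_nonneg _)
  refine ⟨hpos, streamCov s, hS, ?_, fun l => ⟨?_, ?_⟩⟩
  · refine le_of_eq_of_le ?_ hP
    refine Finset.sum_congr rfl fun l _ => ?_
    rw [streamCov, trace_sum, Complex.re_sum]
    refine Finset.sum_congr rfl fun m _ => ?_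
    rw [re_trace_vecMulVec_star]
    simp only [s, WithLp.toLp_smul, WithLp.toLp_ofLp, norm_smul, hT, mul_one, Complex.norm_real,
      Real.norm_eq_abs, sq_abs, Real.sq_sqrt (hp l m)]
  · exact Finset.sum_nonneg fun m _ => Real.log_nonneg (by linarith [hpos l m])
  · rw [← Real.exp_le_exp, Real.exp_sum]
    have hdet := exp_rate_mul_det (H := H) hΦ hS l
    rw [mul_streamCov_mul_conjTranspose, det_add_sum_vecMulVec (hΩ l), mul_comm] at hdet
    replace hdet := mul_right_cancel₀ (hΩ l).det_pos.ne' hdet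
    have hrate : ∏ m, (1 + (star (H l l *ᵥ s l m) ⬝ᵥ ((sicCov (interferenceCov H Φ (streamCov s) l)
        (fun n => H l l *ᵥ s l n) m)⁻¹ *ᵥ (H l l *ᵥ s l m))).re) =
        Real.exp (rate H Φ (streamCov s) l) := by
      apply Complex.ofReal_injective
      rw [Complex.ofReal_prod, ← hdet]
      refine Finset.prod_congr rfl fun m _ => ?_
      rw [Complex.ofReal_add, Complex.ofReal_one,
        ofReal_re_star_dotProduct_mulVec (hQ l m).inv.posSemidef]
    rw [← hrate]
    refine Finset.prod_le_prod (fun m _ => (Real.exp_pos _).le) fun m _ => ?_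
    rw [Real.exp_log (by linarith [hpos l m]), hsinr]
    gcongr
    refine div_le_of_le_mul₀ ((hQ l m).posSemidef.re_dotProduct_nonneg _)
      ((hQ l m).inv.posSemidef.re_dotProduct_nonneg _) ?_
    rw [mul_comm]
    exact norm_sq_dotProduct_le (hQ l m) _ _

/-- The streams of each link can be chosen so that all of them reach at least the SINR that
corresponds to an equal share of its rate.
The receivers are designed against the covariances `S` of the given strategy, while the transmitted
covariances are the smaller ones of `exists_rank_reduction`, which only helps. -/
theorem exists_mem_sinrRegion_ge (hH : ∀ l, H l l ≠ 0) (hΦ : ∀ l k, 0 ≤ Φ l k)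
    (hΦdiag : ∀ l, Φ l l = 0) {P : ℝ} {r : Fin L → ℝ} (hr : r ∈ rateRegion H Φ P) :
    ∃ γ ∈ sinrRegion H Φ (fun l => (H l l).rank) P,
      ∀ l m, Real.exp (r l / ((H l l).rank : ℝ)) - 1 ≤ γ l m := by
  obtain ⟨S, hS, hP, hr⟩ := hr
  have hrank : ∀ l, (H l l).rank ≠ 0 := fun l h => hH l (matrix_eq_zero_of_rank_eq_zero h)
  have htx : ∀ l, 0 < tx l := fun l => Nat.pos_of_ne_zero fun h => hH l <| by
    ext i j; exact (Fin.cast h j).elim0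
  have hrx : ∀ l, 0 < rx l := fun l => Nat.pos_of_ne_zero fun h => hH l <| by
    ext i j; exact (Fin.cast h i).elim0
  have hΩ : ∀ l, (interferenceCov H Φ S l).PosDef := interferenceCov_posDef hΦ hS
  choose u hu hHu using fun l => exists_rank_reduction (H l l) (hS l)
  choose s hs hsinr using fun l => exists_equal_split (H l l)
    (Real.exp_pos (rate H Φ S l / ((H l l).rank : ℝ))) (u l) (hΩ l) (by
      rw [hHu, exp_rate_mul_det hΦ hS, ← Real.exp_nat_mul,
        mul_div_cancel₀ _ (Nat.cast_ne_zero.2 (hrank l))])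
  have hle : ∀ l, (S l - streamCov s l).PosSemidef := by
    intro l; rw [streamCov, hs]; exact hu l
  have hQ : ∀ l m, (sicCov (interferenceCov H Φ S l)
      (fun n => H l l *ᵥ s l n) m).PosDef := fun l m => sicCov_posDef (hΩ l) _ m
  choose T hT hsT using fun l m => exists_unit_eq_norm_smul (htx l) (s l m)
  choose R hR hsR using fun l m => exists_unit_mmse_receiver (hrx l) (hQ l m) (H l l *ᵥ s l m)
  let p : ∀ l : Fin L, Fin (H l l).rank → ℝ := fun l m => ‖WithLp.toLp 2 (s l m)‖ ^ 2
  have hp : ∀ l m, 0 ≤ p l m := fun l m => sq_nonneg _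
  refine ⟨sinr H Φ T R p, ⟨T, R, p, hT, hR, hp, ?_, fun _ _ => rfl⟩, fun l m => ?_⟩
  · refine le_trans (Finset.sum_le_sum fun l _ => ?_) hP
    have h := Complex.le_def.1 (hle l).trace_nonneg |>.1
    rw [trace_sub, Complex.sub_re, streamCov, trace_sum, Complex.re_sum] at h
    simp_rw [re_trace_vecMulVec_star] at h
    exact sub_nonneg.1 h
  · rw [sinr_eq_div hΦdiag hR hp (s := s) (fun l m => by
      rw [Real.sqrt_sq (norm_nonneg _)]; exact hsT l m)]
    have hQ' := sicCov_posDef (interferenceCov_posDef (H := H) hΦ (streamCov_posSemidef s) l)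
      (fun n => H l l *ᵥ s l n) m
    have hR0 : (R l m).ofLp ≠ 0 := by
      intro h
      have := hR l m
      rw [(WithLp.ofLp_eq_zero 2).1 h, norm_zero] at this
      exact zero_ne_one this
    refine (le_div_iff₀ (hQ'.re_dotProduct_pos hR0)).2 ?_
    have hq := hsR l m
    rw [hsinr, Complex.sub_re, Complex.ofReal_re, Complex.one_re] at hq
    have hrate : r l / ((H l l).rank : ℝ) ≤ rate H Φ S l / ((H l l).rank : ℝ) :=
      div_le_div_of_nonneg_right (hr l).2 (Nat.cast_nonneg _)
    have hrate0 : 0 ≤ rate H Φ S l / ((H l l).rank : ℝ) :=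
      div_nonneg ((hr l).1.trans (hr l).2) (Nat.cast_nonneg _)
    refine le_trans (mul_le_mul (sub_le_sub_right (Real.exp_le_exp.2 hrate) 1) ?_
      (hQ'.posSemidef.re_dotProduct_nonneg _) (sub_nonneg.2 (Real.one_le_exp hrate0))) hq
    have h := (interferenceCov_sub_posSemidef (H := H) hΦ hle l).re_dotProduct_nonneg (R l m).ofLp
    rw [sub_mulVec, dotProduct_sub, map_sub, sub_nonneg] at h
    simp only [sicCov, add_mulVec, dotProduct_add, Complex.add_re]
    exact add_le_add_left h _

end

end BMAC

theorem mainTheorem2 {L : ℕ} {tx rx : Fin L → ℕ}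
    (H : ∀ l k : Fin L, Matrix (Fin (rx l)) (Fin (tx k)) ℂ)
    (hH : ∀ l, H l l ≠ 0)
    (Φ : Matrix (Fin L) (Fin L) ℝ) (hΦ : ∀ l k, 0 ≤ Φ l k) (hΦdiag : ∀ l, Φ l l = 0)
    (P : ℝ) (I : Fin L → ℝ) :
    BMAC.IsParetoOptimal (BMAC.sinrRegion H Φ (fun l => (H l l).rank) P)
        (fun l _ => Real.exp (I l / ((H l l).rank : ℝ)) - 1) ↔
      BMAC.IsParetoOptimal (BMAC.rateRegion H Φ P) I := by
  have hrank : ∀ l, 0 < ((H l l).rank : ℝ) := fun l =>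
    Nat.cast_pos.2 (Nat.pos_of_ne_zero fun h => hH l (BMAC.matrix_eq_zero_of_rank_eq_zero h))
  have hsum : ∀ (J : Fin L → ℝ) (l : Fin L), ∑ _m : Fin (H l l).rank,
      Real.log (1 + (Real.exp (J l / ((H l l).rank : ℝ)) - 1)) = J l := by
    intro J l
    rw [add_sub_cancel, Real.log_exp, Finset.sum_const, Finset.card_univ, Fintype.card_fin,
      nsmul_eq_mul, mul_div_cancel₀ _ (hrank l).ne']
  constructor
  · rintro ⟨hmem, hmax⟩
    refine ⟨?_, fun J hJ hIJ l => ?_⟩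
    · have := (BMAC.sum_log_mem_rateRegion hΦ hΦdiag hmem).2
      simpa only [hsum] using this
    · obtain ⟨γ, hγ, hJγ⟩ := BMAC.exists_mem_sinrRegion_ge hH hΦ hΦdiag hJ
      have hle := hmax hγ fun l m => (sub_le_sub_right (Real.exp_le_exp.2
        (div_le_div_of_nonneg_right (hIJ l) (hrank l).le)) 1).trans (hJγ l m)
      have h := (hJγ l ⟨0, Nat.cast_pos.1 (hrank l)⟩).trans (hle l _)
      rwa [sub_le_sub_iff_right, Real.exp_le_exp, div_le_div_iff_of_pos_right (hrank l)] at h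
  · rintro ⟨hmem, hmax⟩
    -- An SINR vector above the equal-SINR point has stream rates at least `I`, hence equal to `I`
    -- by optimality, so no stream can exceed its share.
    have key : ∀ γ ∈ BMAC.sinrRegion H Φ (fun l => (H l l).rank) P,
        (fun l _ => Real.exp (I l / ((H l l).rank : ℝ)) - 1) ≤ γ →
        γ = fun l _ => Real.exp (I l / ((H l l).rank : ℝ)) - 1 := by
      intro γ hγ hIγ
      have hpos : ∀ l, 0 < 1 + (Real.exp (I l / ((H l l).rank : ℝ)) - 1) := fun l => by
        rw [add_sub_cancel]; exact Real.exp_pos _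
      have hlog : ∀ l m, Real.log (1 + (Real.exp (I l / ((H l l).rank : ℝ)) - 1)) ≤
          Real.log (1 + γ l m) := fun l m =>
        Real.log_le_log (hpos l) (add_le_add_right (hIγ l m) 1)
      have hIle : I ≤ fun l => ∑ m, Real.log (1 + γ l m) := fun l => by
        rw [← hsum I l]
        exact Finset.sum_le_sum fun m _ => hlog l m
      have hle := hmax (BMAC.sum_log_mem_rateRegion hΦ hΦdiag hγ).2 hIle
      funext l m
      by_contra hne
      refine (hle l).not_gt ?_
      rw [← hsum I l]
      refine Finset.sum_lt_sum (fun m _ => hlog l m) ⟨m, Finset.mem_univ m, ?_⟩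
      exact Real.log_lt_log (hpos l)
        (add_lt_add_right (lt_of_le_of_ne (hIγ l m) (Ne.symm hne)) 1)
    obtain ⟨γ, hγ, hIγ⟩ := BMAC.exists_mem_sinrRegion_ge hH hΦ hΦdiag hmem
    refine ⟨key γ hγ hIγ ▸ hγ, fun γ' hγ' hle => (key γ' hγ' hle).le⟩
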